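/- Let $B$ be the Bernoulli channel with input alphabet $[0,1]$ and output alphabet $\{0,1\}$: on input $x$ it outputs $1$ with probability $x$ and $0$ with probability $1-x$. For $u=(u_1,\dots,u_n)\in[0,1]^n$ let $B^n(\cdot\mid u)=\bigotimes_{k=1}^n B(\cdot\mid u_k)$ be the output distribution of $n$ memoryless uses. For $\lambda_1,\lambda_2>0$, an $(n,N,\lambda_1,\lambda_2)$ deterministic identification (DI) code for $B$ is a family $\{(u_i,\mathcal D_i)\}_{i=1}^N$ with $u_i\in[0,1]^n$ and $\mathcal D_i\subseteq\{0,1\}^n$ such that, for all distinct $i,j\in\{1,\dots,N\}$, $B^n(\mathcal D_i\mid u_i)\ge 1-\lambda_1$ and $B^n(\mathcal D_j\mid u_i)\le\lambda_2$. (For $N=1$ only the first condition, for the single code word, is imposed.) A number $\dot R>0$ is an achievable linearithmic rate if there are $(n,N^{(n)},\lambda_1^{(n)},\lambda_2^{(n)})$ DI codes, $n\ge1$, such that $\lambda_1^{(n)}\to0$, $\lambda_2^{(n)}\to0$ and $\frac{\log N^{(n)}}{n\log n}\to\dot R$ as $n\to\infty$. The linearithmic DI capacity $\dot C_{\mathrm{DI}}(B)$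 is the largest achievable linearithmic rate. **Corollary.** The linearithmic deterministic identification capacity of the Bernoulli channel is $\dot C_{\mathrm{DI}}(B)=\frac12$; that is, $\frac12$ is an achievable linearithmic rate for $B$, and no achievable linearithmic rate for $B$ exceeds $\frac12$. -/

import Mathlib

open MeasureTheory ProbabilityTheory Filter Topology
open scoped unitInterval

/-- The memoryless extension `W^n(· | u)` of a channel `W` (a Markov kernel from the input alphabet
`𝒳` to the output alphabet `𝒴`) at the input word `u = (u_1, …, u_n)`: the outputs are independent,
the `k`-th one distributed according to `W(· | u_k)`. -/
noncomputable def blockOutput {𝒳 𝒴 : Type*} [MeasurableSpace 𝒳] [MeasurableSpace 𝒴]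
    (W : Kernel 𝒳 𝒴) {n : ℕ} (u : Fin n → 𝒳) : Measure (Fin n → 𝒴) :=
  Measure.pi fun k => W (u k)

/-- An `(n, N, lam₁, lam₂)` deterministic identification (DI) code for the channel `W`: code words
`u_i ∈ 𝒳^n` and output regions `D_i ⊆ 𝒴^n`, `i ∈ [N]`, such that for all distinct `i, j`,
`W^n(D_i | u_i) ≥ 1 - lam₁` and `W^n(D_j | u_i) ≤ lam₂`. -/
structure DICode {𝒳 𝒴 : Type*} [MeasurableSpace 𝒳] [MeasurableSpace 𝒴]
    (W : Kernel 𝒳 𝒴) (n N : ℕ) (lam₁ lam₂ : ℝ) where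
  /-- the code words -/
  word : Fin N → (Fin n → 𝒳)
  /-- the acceptance regions -/
  region : Fin N → Set (Fin n → 𝒴)
  measurableSet_region : ∀ i, MeasurableSet (region i)
  lam₁_pos : 0 < lam₁
  lam₂_pos : 0 < lam₂
  /-- missed identification has probability at most `lam₁` -/
  missed : ∀ i, 1 - lam₁ ≤ (blockOutput W (word i)).real (region i)
  /-- false identification has probability at most `lam₂` -/
  false_id : ∀ i j, i ≠ j → (blockOutput W (word i)).real (region j) ≤ lam₂

/-- `R > 0` is an achievable linearithmic DI rate of `W`: there are
`(n, N n, lam₁ n, lam₂ n)` DI codes, one for every block length `n ≥ 1`, with both error bounds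
tending to `0` and `log (N n) / (n log n)` tending to `R`. -/
def IsAchievableLinearithmicRate {𝒳 𝒴 : Type*} [MeasurableSpace 𝒳] [MeasurableSpace 𝒴]
    (W : Kernel 𝒳 𝒴) (R : ℝ) : Prop :=
  0 < R ∧ ∃ (N : ℕ → ℕ) (lam₁ lam₂ : ℕ → ℝ),
    (∀ n, 1 ≤ n → Nonempty (DICode W n (N n) (lam₁ n) (lam₂ n))) ∧
    Tendsto lam₁ atTop (𝓝 0) ∧ Tendsto lam₂ atTop (𝓝 0) ∧
    Tendsto (fun n : ℕ => Real.log (N n) / (n * Real.log n)) atTop (𝓝 R)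

/-- `C` is the linearithmic DI capacity of `W`: the largest achievable linearithmic rate (in
particular, the maximum is attained). -/
def IsLinearithmicDICapacity {𝒳 𝒴 : Type*} [MeasurableSpace 𝒳] [MeasurableSpace 𝒴]
    (W : Kernel 𝒳 𝒴) (C : ℝ) : Prop :=
  IsGreatest {R : ℝ | IsAchievableLinearithmicRate W R} C

/-- The Bernoulli channel with input alphabet `[0,1]` and output alphabet `{0,1}`: on input `x` the
output is `1` with probability `x` and `0` with probability `1 - x`. -/
noncomputable def bernoulliChannel : Kernel I (Fin 2) where
  toFun x := bernoulliMeasure (1 : Fin 2) 0 x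
  measurable' := by
    refine Measure.measurable_of_measurable_coe _ fun s _ => ?_
    have h1 : Measurable fun x : I => (unitInterval.toNNReal x : ENNReal) := by fun_prop
    have h2 : Measurable fun x : I => (unitInterval.toNNReal (σ x) : ENNReal) := by fun_prop
    exact (h1.mul_const (Measure.dirac (1 : Fin 2) s)).add
      (h2.mul_const (Measure.dirac (0 : Fin 2) s))

instance : IsMarkovKernel bernoulliChannel where
  isProbabilityMeasure x := inferInstanceAs (IsProbabilityMeasure (bernoulliMeasure (1 : Fin 2) 0 x))

theorem bernoulliChannel_real_one (x : I) : (bernoulliChannel x).real {1} = x := by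
  change (bernoulliMeasure (1 : Fin 2) 0 x).real {1} = x
  rw [bernoulliMeasure_real_apply_of_mem_of_notMem] <;> simp

theorem bernoulliChannel_real_zero (x : I) : (bernoulliChannel x).real {0} = 1 - x := by
  change (bernoulliMeasure (1 : Fin 2) 0 x).real {0} = 1 - x
  rw [bernoulliMeasure_real_apply_of_notMem_of_mem] <;> simp

/-! Converse: in the angle `arcsin √x`, the Bhattacharyya coefficient of two Bernoulli outputs is a
cosine, and it multiplies over the block. Words whose angles agree to within `1 / √n` in every
coordinate have coefficient at least `1 / 2`, while small errors force a smaller one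
(`sum_sqrt_measureReal_le`). So each cell of side `1 / √n` holds at most one code word
(`DICode.card_le`), and the rate is at most `1 / 2`.

Achievability: let the coordinates of a word be `m`-digit base `Q` expansions, the digits at each
level forming a word of a Hamming code. Test a word with one linear statistic per level `l`,
weighted by its own digit tails from level `l` on. If a rival first differs at level `l`, only the
tails `A`, `B` matter; when their norms agree, `⟨B, B - A⟩ = |B - A|² / 2`, of order `n Q^(-2l-2)`
for fixed `m`. The variance is at most of order `n Q^(-2l)`, so Chebyshev succeeds once `n` exceeds
a constant times `Q^(2m+2)`. A single test weighted by the whole word would need about `Q^(4m)`,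
giving only rate `1 / 4`. Pigeonholing on the tail norms costs a factor polynomial in `n`. With `Q ≈
n^(1/(2m+3))` the rate is `(m-1)/(2m+3)`, which tends to `1 / 2`; a diagonal argument attains the
limit. -/

/-! ### Linear tests and Chebyshev's inequality. -/

instance isProbabilityMeasure_blockOutput {𝒳 𝒴 : Type*} [MeasurableSpace 𝒳] [MeasurableSpace 𝒴]
    (W : Kernel 𝒳 𝒴) [IsMarkovKernel W] {n : ℕ} (u : Fin n → 𝒳) :
    IsProbabilityMeasure (blockOutput W u) :=
  inferInstanceAs (IsProbabilityMeasure (Measure.pi fun k => W (u k)))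

theorem integral_bernoulliChannel_sub (x : I) :
    ∫ y : Fin 2, ((y : ℕ) : ℝ) - x ∂(bernoulliChannel x) = 0 := by
  change ∫ y : Fin 2, ((y : ℕ) : ℝ) - x ∂(bernoulliMeasure (1 : Fin 2) 0 x) = 0
  rw [integral_bernoulliMeasure]
  simp
  ring

theorem variance_bernoulliChannel_le (x : I) (w : ℝ) :
    Var[fun y : Fin 2 => w * (((y : ℕ) : ℝ) - x); bernoulliChannel x] ≤ w ^ 2 / 4 := by
  rw [variance_const_mul]
  have h : Var[fun y : Fin 2 => ((y : ℕ) : ℝ) - x; bernoulliChannel x] ≤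
      (((1 - x) - (0 - x : ℝ)) / 2) ^ 2 := by
    refine variance_le_sq_of_bounded (ae_of_all _ fun y => ?_) (by fun_prop)
    have hy : (y : ℕ) ≤ 1 := by omega
    have : ((y : ℕ) : ℝ) ≤ 1 := by exact_mod_cast hy
    exact ⟨by simp, by linarith⟩
  have := mul_le_mul_of_nonneg_left h (sq_nonneg w)
  linarith

/-- Chebyshev's inequality for a linear statistic of the output of the Bernoulli channel. -/
theorem blockOutput_bernoulliChannel_deviation_le {n : ℕ} (v : Fin n → I) (w : Fin n → ℝ) {c : ℝ}
    (hc : 0 < c) :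
    (blockOutput bernoulliChannel v).real
      {y | c ≤ |∑ k, w k * (((y k : ℕ) : ℝ) - v k)|} ≤ (∑ k, w k ^ 2) / (4 * c ^ 2) := by
  set X : (k : Fin n) → Fin 2 → ℝ := fun k y => w k * (((y : ℕ) : ℝ) - v k) with hX
  have hmem : ∀ k, MemLp (X k) 2 (bernoulliChannel (v k)) := fun k => by
    refine MemLp.of_bound (by fun_prop) (|w k| * (1 + |(v k : ℝ)|)) (ae_of_all _ fun y => ?_)
    have hy : (y : ℕ) ≤ 1 := by omega
    have : |((y : ℕ) : ℝ)| ≤ 1 := by rw [Nat.abs_cast]; exact_mod_cast hy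
    rw [hX, Real.norm_eq_abs, abs_mul]
    gcongr
    exact (abs_sub _ _).trans (by gcongr)
  have hmem' : ∀ k, MemLp (fun y : Fin n → Fin 2 => X k (y k)) 2
      (blockOutput bernoulliChannel v) := fun k =>
    (hmem k).comp_measurePreserving (measurePreserving_eval _ k)
  have hsum : MemLp (∑ k, fun y : Fin n → Fin 2 => X k (y k)) 2
      (blockOutput bernoulliChannel v) := memLp_finsetSum' _ fun k _ => hmem' k
  have hmean : ∫ y, (∑ k, fun y : Fin n → Fin 2 => X k (y k)) y
      ∂(blockOutput bernoulliChannel v) = 0 := by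
    simp only [Finset.sum_apply]
    rw [integral_finsetSum _ fun k _ => (hmem' k).integrable (by norm_num)]
    refine Finset.sum_eq_zero fun k _ => ?_
    have := integral_comp_eval (μ := fun k => bernoulliChannel (v k)) (i := k)
      (hmem k).aestronglyMeasurable
    rw [blockOutput, this, hX, integral_const_mul, integral_bernoulliChannel_sub, mul_zero]
  have hvar : Var[∑ k, fun y : Fin n → Fin 2 => X k (y k); blockOutput bernoulliChannel v] ≤
      (∑ k, w k ^ 2) / 4 := by
    rw [blockOutput, variance_sum_pi hmem, Finset.sum_div]
    exact Finset.sum_le_sum fun k _ => variance_bernoulliChannel_le _ _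
  have h := meas_ge_le_variance_div_sq hsum hc
  rw [hmean] at h
  simp only [Finset.sum_apply, sub_zero] at h
  rw [measureReal_def]
  refine ENNReal.toReal_le_of_le_ofReal (by positivity) (h.trans (ENNReal.ofReal_le_ofReal ?_))
  rw [← div_div]
  gcongr

/-- A family of words separated by finitely many linear tests per word is a DI code. -/
theorem nonempty_diCode_of_linear_tests {n N m : ℕ} (word : Fin N → Fin n → I)
    (w : Fin N → Fin m → Fin n → ℝ) (g : Fin m → ℝ) (hg : ∀ l, 0 < g l) {η : ℝ} (hη : 0 < η)
    (hw : ∀ i l, m * ∑ k, w i l k ^ 2 ≤ η * g l ^ 2)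
    (hsep : ∀ i j, i ≠ j → ∃ l, 2 * g l ≤ ∑ k, w j l k * ((word j k : ℝ) - word i k)) :
    Nonempty (DICode bernoulliChannel n N η η) := by
  have hdev : ∀ (v : Fin n → I) (i : Fin N) (l : Fin m), (blockOutput bernoulliChannel v).real
      {y | g l ≤ |∑ k, w i l k * (((y k : ℕ) : ℝ) - v k)|} ≤ η / m := fun v i l => by
    refine (blockOutput_bernoulliChannel_deviation_le v (w i l) (hg l)).trans ?_
    have hm : (0 : ℝ) < m := by exact_mod_cast l.pos
    have hgl := hg l
    rw [div_le_div_iff₀ (by positivity) hm]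
    have := hw i l
    nlinarith [mul_pos hη (pow_pos hgl 2)]
  refine ⟨⟨word, fun i => {y | ∀ l, |∑ k, w i l k * (((y k : ℕ) : ℝ) - word i k)| < g l},
    fun i => Set.Finite.measurableSet (Set.toFinite _), hη, hη, fun i => ?_, fun i j hij => ?_⟩⟩
  · set D : Set (Fin n → Fin 2) :=
      {y | ∀ l, |∑ k, w i l k * (((y k : ℕ) : ℝ) - word i k)| < g l} with hD
    have hcompl : Dᶜ = ⋃ l, {y | g l ≤ |∑ k, w i l k * (((y k : ℕ) : ℝ) - word i k)|} := by
      ext y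
      simp [hD]
    have h1 := probReal_compl_eq_one_sub (μ := blockOutput bernoulliChannel (word i))
      (Set.toFinite D).measurableSet
    have h2 : (blockOutput bernoulliChannel (word i)).real Dᶜ ≤ η := by
      rw [hcompl]
      refine (measureReal_iUnion_fintype_le _).trans
        ((Finset.sum_le_sum fun l _ => hdev (word i) i l).trans ?_)
      rw [Finset.sum_const, Finset.card_univ, Fintype.card_fin, nsmul_eq_mul]
      rcases eq_or_ne (m : ℝ) 0 with h | h
      · simp [h, hη.le]
      · rw [mul_div_cancel₀ _ h]
    linarith
  · obtain ⟨l, hl⟩ := hsep i j hij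
    have hm : (1 : ℝ) ≤ m := by exact_mod_cast l.pos
    refine (measureReal_mono fun y hy => ?_).trans
      ((hdev (word i) j l).trans (div_le_self hη.le hm))
    have h1 := hy l
    have h2 : ∑ k, w j l k * (((y k : ℕ) : ℝ) - word i k) =
        ∑ k, w j l k * (((y k : ℕ) : ℝ) - word j k) +
        ∑ k, w j l k * ((word j k : ℝ) - word i k) := by
      rw [← Finset.sum_add_distrib]
      exact Finset.sum_congr rfl fun k _ => by ring
    -- The mean shift is at least `2 * g l` and the accepted deviation is below `g l`, so a
    -- deviation of at least `g l` from the true mean remains.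
    rw [Set.mem_ofPred_eq, h2]
    exact le_trans (by linarith [(abs_lt.1 h1).1]) (le_abs_self _)

/-! ### Converse: Bhattacharyya coefficients and cell counting. -/

theorem blockOutput_real_singleton {𝒳 𝒴 : Type*} [MeasurableSpace 𝒳] [MeasurableSpace 𝒴]
    (W : Kernel 𝒳 𝒴) [IsMarkovKernel W] {n : ℕ} (u : Fin n → 𝒳) (y : Fin n → 𝒴) :
    (blockOutput W u).real {y} = ∏ k, (W (u k)).real {y k} := by
  simp [blockOutput, measureReal_def, Measure.pi_singleton, ENNReal.toReal_prod]

/-- The Bhattacharyya coefficient of product distributions is the product of the coefficients. -/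
theorem sum_sqrt_blockOutput {𝒳 𝒴 : Type*} [MeasurableSpace 𝒳] [MeasurableSpace 𝒴] [Fintype 𝒴]
    (W : Kernel 𝒳 𝒴) [IsMarkovKernel W] {n : ℕ} (u v : Fin n → 𝒳) :
    ∑ y, √((blockOutput W u).real {y}) * √((blockOutput W v).real {y}) =
      ∏ k, ∑ b, √((W (u k)).real {b}) * √((W (v k)).real {b}) := by
  classical
  rw [Finset.prod_univ_sum, Fintype.piFinset_univ]
  refine Finset.sum_congr rfl fun y _ => ?_
  rw [blockOutput_real_singleton, blockOutput_real_singleton,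
    Real.sqrt_prod _ fun _ _ => measureReal_nonneg, Real.sqrt_prod _ fun _ _ => measureReal_nonneg,
    Finset.prod_mul_distrib]

/-- Cauchy–Schwarz on `A` and on `Aᶜ` separately, then one factor of each product is bounded by `1`.
With `A` a decoding region, the right side is governed by the two error probabilities. -/
theorem sum_sqrt_measureReal_le {α : Type*} [Fintype α] [MeasurableSpace α]
    [MeasurableSingletonClass α] (P Q : Measure α) [IsProbabilityMeasure P]
    [IsProbabilityMeasure Q] (A : Set α) :
    ∑ y, √(P.real {y}) * √(Q.real {y}) ≤ √(Q.real A) + √(P.real Aᶜ) := by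
  classical
  have key : ∀ (s : Set α) [Fintype s], ∑ y ∈ s.toFinset, √(P.real {y}) * √(Q.real {y}) ≤
      √(P.real s) * √(Q.real s) := fun s _ => by
    refine (Real.sum_sqrt_mul_sqrt_le _ (fun _ => measureReal_nonneg)
      (fun _ => measureReal_nonneg)).trans_eq ?_
    simp only [sum_measureReal_singleton, Set.coe_toFinset]
  rw [← Finset.sum_add_sum_compl A.toFinset, ← Set.toFinset_compl]
  refine add_le_add ((key A).trans ?_) ((key Aᶜ).trans ?_)
  · exact mul_le_of_le_one_left (Real.sqrt_nonneg _) (Real.sqrt_le_one.2 measureReal_le_one)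
  · exact mul_le_of_le_one_right (Real.sqrt_nonneg _) (Real.sqrt_le_one.2 measureReal_le_one)

/-- The Bhattacharyya coefficient of two outputs of the Bernoulli channel is the cosine of the
difference of the angles that parametrize the inputs. -/
theorem sum_sqrt_bernoulliChannel (x y : I) :
    ∑ b, √((bernoulliChannel x).real {b}) * √((bernoulliChannel y).real {b}) =
      Real.cos (Real.arcsin √x - Real.arcsin √y) := by
  have hs : ∀ z : I, Real.sin (Real.arcsin √z) = √z := fun z =>
    Real.sin_arcsin (by linarith [Real.sqrt_nonneg (z : ℝ)]) (Real.sqrt_le_one.2 z.2.2)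
  rw [Fin.sum_univ_two, bernoulliChannel_real_zero, bernoulliChannel_real_zero,
    bernoulliChannel_real_one, bernoulliChannel_real_one, Real.cos_sub, hs, hs,
    Real.cos_arcsin, Real.cos_arcsin, Real.sq_sqrt x.2.1, Real.sq_sqrt y.2.1]

/-- Each cosine is at least `1 - 1 / (2n)`, and Bernoulli's inequality bounds the `n`-th power below
by `1 / 2`. -/
theorem half_le_sum_sqrt_blockOutput {n : ℕ} (hn : 1 ≤ n) (u v : Fin n → I)
    (h : ∀ k, n * (Real.arcsin √(u k) - Real.arcsin √(v k)) ^ 2 ≤ 1) :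
    1 / 2 ≤ ∑ y, √((blockOutput bernoulliChannel u).real {y}) *
      √((blockOutput bernoulliChannel v).real {y}) := by
  have hn' : (1 : ℝ) ≤ n := by exact_mod_cast hn
  rw [sum_sqrt_blockOutput]
  have hinv : (n : ℝ)⁻¹ ≤ 1 := inv_le_one_of_one_le₀ hn'
  calc (1 / 2 : ℝ) = 1 + n * (-((n : ℝ)⁻¹ / 2)) := by field_simp; ring
    _ ≤ (1 + -((n : ℝ)⁻¹ / 2)) ^ n := one_add_mul_le_pow (by linarith) n
    _ = ∏ _k : Fin n, (1 + -((n : ℝ)⁻¹ / 2)) := by simp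
    _ ≤ _ := by
      refine Finset.prod_le_prod (fun k _ => by linarith) fun k _ => ?_
      rw [sum_sqrt_bernoulliChannel]
      refine le_trans ?_ (Real.one_sub_sq_div_two_le_cos)
      have : (Real.arcsin √(u k) - Real.arcsin √(v k)) ^ 2 ≤ (n : ℝ)⁻¹ := by
        rw [← one_div, le_div_iff₀ (by linarith), mul_comm]
        exact h k
      linarith

/-- The number of words of a DI code of the Bernoulli channel with small errors is bounded by the
number of cells of side length `1 / √n` in the space of angles. -/
theorem DICode.card_le {n N : ℕ} (hn : 1 ≤ n) {lam₁ lam₂ : ℝ}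
    (c : DICode bernoulliChannel n N lam₁ lam₂) (hlam : √lam₁ + √lam₂ < 1 / 2) :
    N ≤ (⌊2 * √n⌋₊ + 1) ^ n := by
  have hn' : (1 : ℝ) ≤ n := by exact_mod_cast hn
  have hang : ∀ x : I, 0 ≤ Real.arcsin √x ∧ Real.arcsin √x ≤ 2 := fun x =>
    ⟨Real.arcsin_nonneg.2 (Real.sqrt_nonneg _),
      (Real.arcsin_le_pi_div_two _).trans (by linarith [Real.pi_le_four])⟩
  let cell : Fin N → Fin n → Fin (⌊2 * √n⌋₊ + 1) := fun i k =>
    ⟨⌊Real.arcsin √(c.word i k) * √n⌋₊, Nat.lt_succ_of_le (Nat.floor_le_floor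
      (mul_le_mul_of_nonneg_right (hang _).2 (Real.sqrt_nonneg _)))⟩
  have hinj : Function.Injective cell := fun i j hij => by
    by_contra hne
    have h1 := half_le_sum_sqrt_blockOutput hn (c.word i) (c.word j) fun k => by
      have hk : ⌊Real.arcsin √(c.word i k) * √n⌋₊ = ⌊Real.arcsin √(c.word j k) * √n⌋₊ :=
        congrArg Fin.val (congrFun hij k)
      have ha := Nat.floor_le (mul_nonneg (hang (c.word i k)).1 (Real.sqrt_nonneg n))
      have hb := Nat.lt_floor_add_one (Real.arcsin √(c.word i k) * √n)
      have ha' := Nat.floor_le (mul_nonneg (hang (c.word j k)).1 (Real.sqrt_nonneg n))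
      have hb' := Nat.lt_floor_add_one (Real.arcsin √(c.word j k) * √n)
      rw [hk] at ha hb
      have hsq : ((Real.arcsin √(c.word i k) - Real.arcsin √(c.word j k)) * √n) ^ 2 ≤ 1 := by
        rw [sq_le_one_iff_abs_le_one, abs_le, sub_mul]
        constructor <;> linarith
      rwa [mul_pow, Real.sq_sqrt (by linarith), mul_comm] at hsq
    have h2 := sum_sqrt_measureReal_le (blockOutput bernoulliChannel (c.word i))
      (blockOutput bernoulliChannel (c.word j)) (c.region i)
    have h3 := Real.sqrt_le_sqrt (c.false_id j i (Ne.symm hne))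
    have h4 : (blockOutput bernoulliChannel (c.word i)).real (c.region i)ᶜ ≤ lam₁ := by
      rw [probReal_compl_eq_one_sub (c.measurableSet_region i)]
      linarith [c.missed i]
    linarith [Real.sqrt_le_sqrt h4]
  simpa using Fintype.card_le_of_injective cell hinj

/-! ### Hamming codes. -/

/-- Choose the set of changed positions (at most `2 ^ n` ways), then the new letters there. -/
theorem card_hammingDist_le {n q : ℕ} (hq : 0 < q) (s : ℕ) (c : Fin n → Fin q) :
    (Finset.univ.filter fun x : Fin n → Fin q => hammingDist c x ≤ s).card ≤ 2 ^ n * q ^ s := by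
  classical
  have hsub : (Finset.univ.filter fun x : Fin n → Fin q => hammingDist c x ≤ s) ⊆
      (Finset.univ.filter fun S : Finset (Fin n) => S.card ≤ s).biUnion fun S =>
        Fintype.piFinset fun k => if k ∈ S then Finset.univ else {c k} := fun x hx => by
    refine Finset.mem_biUnion.2 ⟨Finset.univ.filter fun k => c k ≠ x k, ?_, ?_⟩
    · simpa [hammingDist] using hx
    · refine Fintype.mem_piFinset.2 fun k => ?_
      by_cases h : c k = x k <;> simp [h]
  refine (Finset.card_le_card hsub).trans ((Finset.card_biUnion_le_card_mul _ _ (q ^ s)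
    fun S hS => ?_).trans (Nat.mul_le_mul_right _ ?_))
  · rw [Fintype.card_piFinset]
    have : ∀ k, (if k ∈ S then (Finset.univ : Finset (Fin q)) else {c k}).card =
        if k ∈ S then q else 1 := fun k => by split_ifs <;> simp
    simp only [this, Finset.prod_ite_mem, Finset.univ_inter, Finset.prod_const]
    exact Nat.pow_le_pow_right hq (by simpa using hS)
  · exact (Finset.card_le_univ _).trans (by simp)

/-- The Gilbert–Varshamov bound, with a crude bound on the size of Hamming balls. -/
theorem exists_code_hammingDist_gt {n q : ℕ} (hq : 0 < q) (s : ℕ) :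
    ∃ C : Finset (Fin n → Fin q), (∀ x ∈ C, ∀ y ∈ C, x ≠ y → s < hammingDist x y) ∧
      q ^ n ≤ C.card * (2 ^ n * q ^ s) := by
  classical
  obtain ⟨C, hC, hmax⟩ := Finset.exists_max_image
    (Finset.univ.filter fun C : Finset (Fin n → Fin q) =>
      ∀ x ∈ C, ∀ y ∈ C, x ≠ y → s < hammingDist x y) Finset.card ⟨∅, by simp⟩
  simp only [Finset.mem_filter, Finset.mem_univ, true_and] at hC hmax
  refine ⟨C, hC, ?_⟩
  have hcover : (Finset.univ : Finset (Fin n → Fin q)) ⊆ C.biUnion fun c =>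
      Finset.univ.filter fun x => hammingDist c x ≤ s := fun x _ => by
    by_contra hx
    simp only [Finset.mem_biUnion, Finset.mem_filter, Finset.mem_univ, true_and, not_exists,
      not_and, not_le] at hx
    have hxC : x ∉ C := fun h => by simpa using hx x h
    -- An uncovered word could be added to the code, contradicting maximality.
    have := hmax (insert x C) fun a ha b hb hab => by
      rcases Finset.mem_insert.1 ha with ha' | ha' <;> rcases Finset.mem_insert.1 hb with hb' | hb'
      · exact absurd (ha'.trans hb'.symm) hab
      · rw [ha', hammingDist_comm]; exact hx b hb'
      · rw [hb']; exact hx a ha'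
      · exact hC a ha' b hb' hab
    rw [Finset.card_insert_of_notMem hxC] at this
    omega
  have := (Finset.card_le_card hcover).trans
    (Finset.card_biUnion_le_card_mul _ _ _ fun c _ => card_hammingDist_le hq s c)
  simpa using this

/-! ### Digit expansions with gaps. -/

/-- The part `∑_{l ≤ j < m} d_j Q^{-(j+1)}` of a base `Q` expansion with `m` digits. -/
noncomputable def digitTail (Q m : ℕ) (d : ℕ → ℕ) (l : ℕ) : ℝ :=
  ∑ j ∈ Finset.Ico l m, (d j : ℝ) / (Q : ℝ) ^ (j + 1)

theorem digitTail_nonneg (Q m : ℕ) (d : ℕ → ℕ) (l : ℕ) : 0 ≤ digitTail Q m d l :=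
  Finset.sum_nonneg fun _ _ => by positivity

/-- Digits stay below half the base, so the tail is at most half a unit of the preceding digit; the
termwise bound telescopes. -/
theorem digitTail_le {q m : ℕ} {d : ℕ → ℕ} (hd : ∀ j < m, d j < q) (l : ℕ) :
    digitTail (2 * q) m d l ≤ 1 / (2 * ((2 * q : ℕ) : ℝ) ^ l) := by
  rcases lt_or_ge l m with hl | hl
  swap
  · rw [digitTail, Finset.Ico_eq_empty_of_le hl, Finset.sum_empty]
    positivity
  have hq : 0 < q := (Nat.zero_le _).trans_lt (hd l hl)
  set Q : ℝ := ((2 * q : ℕ) : ℝ) with hQ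
  have hQ0 : 0 < Q := by rw [hQ]; positivity
  have hterm : ∀ j ∈ Finset.Ico l m, (d j : ℝ) / Q ^ (j + 1) ≤
      -(1 / (2 * Q ^ (j + 1))) - -(1 / (2 * Q ^ j)) := fun j hj => by
    have h1 : (d j : ℝ) + 1 ≤ q := by exact_mod_cast hd j (Finset.mem_Ico.1 hj).2
    have h2 : Q = 2 * q := by rw [hQ]; push_cast; ring
    have h3 : -(1 / (2 * Q ^ (j + 1))) - -(1 / (2 * Q ^ j)) = ((Q - 1) / 2) / Q ^ (j + 1) := by
      rw [pow_succ]; field_simp; ring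
    rw [h3]
    gcongr
    linarith
  refine (Finset.sum_le_sum hterm).trans ?_
  rw [Finset.sum_Ico_sub (fun j => -(1 / (2 * Q ^ j))) hl.le]
  have : 0 < 1 / (2 * Q ^ m) := by positivity
  linarith

theorem digitTail_eq_add {Q m l : ℕ} (d : ℕ → ℕ) (hl : l < m) :
    digitTail Q m d l = (d l : ℝ) / (Q : ℝ) ^ (l + 1) + digitTail Q m d (l + 1) := by
  rw [digitTail, Finset.sum_eq_sum_Ico_succ_bot hl, digitTail]

theorem digitTail_sub_of_agree {Q m l : ℕ} {d e : ℕ → ℕ} (hl : l ≤ m) (h : ∀ j < l, d j = e j) :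
    digitTail Q m d 0 - digitTail Q m e 0 = digitTail Q m d l - digitTail Q m e l := by
  simp only [digitTail]
  rw [← Finset.sum_Ico_consecutive _ (Nat.zero_le l) hl, ← Finset.sum_Ico_consecutive
    (fun j => (e j : ℝ) / (Q : ℝ) ^ (j + 1)) (Nat.zero_le l) hl,
    Finset.sum_congr rfl fun j hj => by rw [h j (Finset.mem_Ico.1 hj).2]]
  ring

/-- Differing leading digits contribute at least one unit `1 / Q ^ (l + 1)`, and later digits can
cancel at most half of it. -/
theorem sq_digitTail_sub_ge {q m l : ℕ} {d e : ℕ → ℕ} (hd : ∀ j < m, d j < q)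
    (he : ∀ j < m, e j < q) (hl : l < m) (hne : d l ≠ e l) :
    (1 / (2 * ((2 * q : ℕ) : ℝ) ^ (l + 1))) ^ 2 ≤
      (digitTail (2 * q) m d l - digitTail (2 * q) m e l) ^ 2 := by
  have hq : 0 < q := (Nat.zero_le _).trans_lt (hd l hl)
  have key : ∀ d e : ℕ → ℕ, (∀ j < m, d j < q) → (∀ j < m, e j < q) → d l < e l →
      1 / (2 * ((2 * q : ℕ) : ℝ) ^ (l + 1)) ≤
        digitTail (2 * q) m e l - digitTail (2 * q) m d l := fun d e hd he hlt => by
    rw [digitTail_eq_add d hl, digitTail_eq_add e hl]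
    have h1 := digitTail_le hd (l + 1)
    have h2 := digitTail_nonneg (2 * q) m e (l + 1)
    set T : ℝ := ((2 * q : ℕ) : ℝ) ^ (l + 1) with hT
    have hT0 : 0 < T := by positivity
    have h3 : ((d l : ℝ) + 1) / T ≤ (e l : ℝ) / T := by
      gcongr
      exact_mod_cast hlt
    have h4 : 1 / T = 2 * (1 / (2 * T)) := by field_simp
    rw [add_div] at h3
    linarith
  rcases lt_or_gt_of_ne hne with h | h
  · rw [← neg_sub, neg_sq]
    exact pow_le_pow_left₀ (by positivity) (key d e hd he h) 2
  · exact pow_le_pow_left₀ (by positivity) (key e d he hd h) 2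

/-- `Q ^ m` times `digitTail Q m d l`, as a natural number. -/
def digitTailNum (Q m : ℕ) (d : ℕ → ℕ) (l : ℕ) : ℕ :=
  ∑ j ∈ Finset.Ico l m, d j * Q ^ (m - (j + 1))

theorem digitTail_mul_pow {Q : ℕ} (hQ : 0 < Q) (m : ℕ) (d : ℕ → ℕ) (l : ℕ) :
    digitTail Q m d l * (Q : ℝ) ^ m = digitTailNum Q m d l := by
  have hQ' : (Q : ℝ) ≠ 0 := by positivity
  rw [digitTail, digitTailNum, Finset.sum_mul]
  push_cast
  refine Finset.sum_congr rfl fun j hj => ?_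
  have := (Finset.mem_Ico.1 hj).2
  rw [pow_sub₀ _ hQ' (by omega)]
  field_simp

/-- The digits at position `k` of a tuple of words. -/
def wordDigits {m n q : ℕ} (a : Fin m → Fin n → Fin q) (k : Fin n) (j : ℕ) : ℕ :=
  if h : j < m then a ⟨j, h⟩ k else 0

theorem wordDigits_lt {m n q : ℕ} (a : Fin m → Fin n → Fin q) (k : Fin n) {j : ℕ} (hj : j < m) :
    wordDigits a k j < q := by
  simp [wordDigits, hj]

/-- The input word whose base `2 q` digits are given by a tuple of words over `Fin q`. -/
noncomputable def digitWord {m n q : ℕ} (a : Fin m → Fin n → Fin q) (k : Fin n) : I :=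
  ⟨digitTail (2 * q) m (wordDigits a k) 0, digitTail_nonneg _ _ _ _,
    (digitTail_le (fun _ hj => wordDigits_lt a k hj) 0).trans (by norm_num)⟩

/-! ### The code construction. -/

/-- Equal norms turn the inner product into half a squared distance, to which each of the more than
`s` differing positions contributes. -/
theorem sum_digitTail_mul_sub_ge {m n q s : ℕ} {a b : Fin m → Fin n → Fin q} {l : Fin m}
    (hag : ∀ j < l, a j = b j) (hdist : s < hammingDist (a l) (b l))
    (hnorm : ∑ k, digitTail (2 * q) m (wordDigits a k) l ^ 2 =
      ∑ k, digitTail (2 * q) m (wordDigits b k) l ^ 2) :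
    2 * ((s + 1) / (16 * ((2 * q : ℕ) : ℝ) ^ (2 * (l : ℕ) + 2))) ≤
      ∑ k, digitTail (2 * q) m (wordDigits b k) l * ((digitWord b k : ℝ) - digitWord a k) := by
  have hsub : ∀ k, (digitWord b k : ℝ) - digitWord a k =
      digitTail (2 * q) m (wordDigits b k) l - digitTail (2 * q) m (wordDigits a k) l := fun k =>
    digitTail_sub_of_agree l.2.le fun j hj => by
      have hjm := hj.trans l.2
      simp only [wordDigits, hjm, dite_true]
      rw [hag ⟨j, hjm⟩ hj]
  set A : Fin n → ℝ := fun k => digitTail (2 * q) m (wordDigits a k) l with hA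
  set B : Fin n → ℝ := fun k => digitTail (2 * q) m (wordDigits b k) l with hB
  set Q : ℝ := ((2 * q : ℕ) : ℝ) with hQ
  have h1 : ∑ k, B k * ((digitWord b k : ℝ) - digitWord a k) = (∑ k, (A k - B k) ^ 2) / 2 := by
    have h2 : ∀ k, B k * ((digitWord b k : ℝ) - digitWord a k) =
        (A k - B k) ^ 2 / 2 + (B k ^ 2 - A k ^ 2) / 2 := fun k => by
      rw [hsub]; simp only [hA, hB]; ring
    rw [Finset.sum_congr rfl fun k _ => h2 k, Finset.sum_add_distrib, ← Finset.sum_div,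
      ← Finset.sum_div, Finset.sum_sub_distrib, hnorm, sub_self, zero_div, add_zero]
  have h2 : ((s : ℝ) + 1) * (1 / (2 * Q ^ ((l : ℕ) + 1))) ^ 2 ≤ ∑ k, (A k - B k) ^ 2 := by
    calc ((s : ℝ) + 1) * (1 / (2 * Q ^ ((l : ℕ) + 1))) ^ 2
        ≤ (hammingDist (a l) (b l) : ℝ) * (1 / (2 * Q ^ ((l : ℕ) + 1))) ^ 2 := by
          gcongr
          exact_mod_cast hdist
      _ = ∑ k ∈ Finset.univ.filter fun k => a l k ≠ b l k,
            (1 / (2 * Q ^ ((l : ℕ) + 1))) ^ 2 := by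
          rw [Finset.sum_const, nsmul_eq_mul]; rfl
      _ ≤ ∑ k ∈ Finset.univ.filter fun k => a l k ≠ b l k, (A k - B k) ^ 2 := by
          refine Finset.sum_le_sum fun k hk => sq_digitTail_sub_ge
            (fun _ hj => wordDigits_lt a k hj) (fun _ hj => wordDigits_lt b k hj) l.2 ?_
          simp only [wordDigits, l.2, dite_true]
          exact fun h => (Finset.mem_filter.1 hk).2 (Fin.ext h)
      _ ≤ _ := Finset.sum_le_univ_sum_of_nonneg fun k => sq_nonneg _
  rw [h1]
  have h3 : ((s : ℝ) + 1) * (1 / (2 * Q ^ ((l : ℕ) + 1))) ^ 2 =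
      4 * ((s + 1) / (16 * Q ^ (2 * (l : ℕ) + 2))) := by
    rw [show 2 * (l : ℕ) + 2 = ((l : ℕ) + 1) * 2 by ring, pow_mul Q]
    simp only [div_eq_mul_inv, mul_inv, mul_pow, one_mul, inv_pow]
    ring
  linarith

theorem nonempty_diCode_of_digits {m n q s : ℕ} (hq : 0 < q) {η : ℝ} (hη : 0 < η)
    (hcond : 64 * m * n * ((2 * q : ℕ) : ℝ) ^ (2 * m + 2) ≤ η * (s + 1) ^ 2)
    {C : Finset (Fin n → Fin q)} (hC : ∀ x ∈ C, ∀ y ∈ C, x ≠ y → s < hammingDist x y)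
    (S : Finset (Fin m → Fin n → Fin q)) (hSC : ∀ a ∈ S, ∀ l, a l ∈ C)
    (hnorm : ∀ a ∈ S, ∀ b ∈ S, ∀ l : Fin m, ∑ k, digitTail (2 * q) m (wordDigits a k) l ^ 2 =
      ∑ k, digitTail (2 * q) m (wordDigits b k) l ^ 2) :
    Nonempty (DICode bernoulliChannel n S.card η η) := by
  let e := S.equivFin.symm
  set Q : ℝ := ((2 * q : ℕ) : ℝ) with hQ
  have hQ1 : 1 ≤ Q := by rw [hQ]; exact_mod_cast (by omega : 1 ≤ 2 * q)
  have hQ0 : 0 < Q := by linarith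
  refine nonempty_diCode_of_linear_tests (m := m) (fun i => digitWord (e i).1)
    (fun i l k => digitTail (2 * q) m (wordDigits (e i).1 k) l)
    (fun l => (s + 1) / (16 * Q ^ (2 * (l : ℕ) + 2))) (fun l => by positivity) hη
    (fun i l => ?_) fun i j hij => ?_
  · have h1 : ∑ k, digitTail (2 * q) m (wordDigits (e i).1 k) l ^ 2 ≤
        n * (1 / (2 * Q ^ (l : ℕ))) ^ 2 := by
      refine (Finset.sum_le_card_nsmul _ _ _ fun k _ => pow_le_pow_left₀
        (digitTail_nonneg _ _ _ _) (digitTail_le (fun _ hj => wordDigits_lt _ k hj) l) 2).trans_eq ?_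
      rw [Finset.card_univ, Fintype.card_fin, nsmul_eq_mul]
    -- The last level `l = m - 1` is the most demanding one.
    have hl : 2 * (l : ℕ) + 4 ≤ 2 * m + 2 := by omega
    have h2 : 64 * m * n * Q ^ (2 * (l : ℕ) + 4) ≤ η * (s + 1) ^ 2 :=
      le_trans (by gcongr) hcond
    calc (m : ℝ) * ∑ k, digitTail (2 * q) m (wordDigits (e i).1 k) l ^ 2
        ≤ m * (n * (1 / (2 * Q ^ (l : ℕ))) ^ 2) := by gcongr
      _ = (64 * m * n * Q ^ (2 * (l : ℕ) + 4)) / (16 * Q ^ (2 * (l : ℕ) + 2)) ^ 2 := by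
          have hp : 0 < Q ^ (l : ℕ) := by positivity
          rw [pow_add, pow_add, show 2 * (l : ℕ) = l * 2 by ring, pow_mul]
          field_simp
          ring
      _ ≤ (η * (s + 1) ^ 2) / (16 * Q ^ (2 * (l : ℕ) + 2)) ^ 2 := by gcongr
      _ = _ := by rw [div_pow, mul_div_assoc]
  · have hne : (e i).1 ≠ (e j).1 := fun h => hij (e.injective (Subtype.ext h))
    have hex : ∃ l : ℕ, ∃ h : l < m, (e i).1 ⟨l, h⟩ ≠ (e j).1 ⟨l, h⟩ := by
      obtain ⟨l, hl⟩ := Function.ne_iff.1 hne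
      exact ⟨l, l.2, hl⟩
    classical
    -- The separating test is the one at the first level where the two tuples differ.
    obtain ⟨hlm, hl⟩ := Nat.find_spec hex
    refine ⟨⟨Nat.find hex, hlm⟩, sum_digitTail_mul_sub_ge (fun k hk => ?_)
      (hC _ (hSC _ (e i).2 _) _ (hSC _ (e j).2 _) hl) (hnorm _ (e i).2 _ (e j).2 _)⟩
    by_contra hk'
    exact Nat.find_min hex hk ⟨k.2, hk'⟩

/-- Pigeonhole: after scaling by `Q ^ (2 * m)` the squared tail norms are integers of bounded size,
so a largest fibre of the norm profile is a code with all norms equal. -/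
theorem exists_diCode_card_ge {m n q s : ℕ} (hq : 0 < q) {η : ℝ} (hη : 0 < η)
    (hcond : 64 * m * n * ((2 * q : ℕ) : ℝ) ^ (2 * m + 2) ≤ η * (s + 1) ^ 2)
    {C : Finset (Fin n → Fin q)} (hC : ∀ x ∈ C, ∀ y ∈ C, x ≠ y → s < hammingDist x y) :
    ∃ N, Nonempty (DICode bernoulliChannel n N η η) ∧
      C.card ^ m ≤ (n * (2 * q) ^ (2 * m) + 1) ^ m * N := by
  classical
  have hQ : 0 < 2 * q := by omega
  let f : (Fin m → Fin n → Fin q) → Fin m → ℕ := fun a l =>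
    ∑ k, digitTailNum (2 * q) m (wordDigits a k) l ^ 2
  let t : Finset (Fin m → ℕ) :=
    Fintype.piFinset fun _ => Finset.range (n * (2 * q) ^ (2 * m) + 1)
  let P : Finset (Fin m → Fin n → Fin q) := Fintype.piFinset fun _ => C
  have hf : ∀ a ∈ P, f a ∈ t := fun a _ => by
    refine Fintype.mem_piFinset.2 fun l => Finset.mem_range.2 (Nat.lt_succ_of_le ?_)
    refine (Finset.sum_le_card_nsmul _ _ (((2 * q) ^ m) ^ 2) fun k _ =>
      Nat.pow_le_pow_left ?_ 2).trans_eq ?_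
    · have h1 := digitTail_le (fun _ hj => wordDigits_lt a k hj) (l : ℕ)
      have h2 : (1 : ℝ) / (2 * ((2 * q : ℕ) : ℝ) ^ (l : ℕ)) ≤ 1 := by
        have : (1 : ℝ) ≤ ((2 * q : ℕ) : ℝ) ^ (l : ℕ) :=
          one_le_pow₀ (by exact_mod_cast (by omega : 1 ≤ 2 * q))
        rw [div_le_one (by positivity)]
        linarith
      have h3 := digitTail_mul_pow hQ m (wordDigits a k) l
      have h4 : (digitTailNum (2 * q) m (wordDigits a k) l : ℝ) ≤ ((2 * q : ℕ) : ℝ) ^ m := by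
        rw [← h3]
        exact mul_le_of_le_one_left (by positivity) (h1.trans h2)
      exact_mod_cast h4
    · rw [Finset.card_univ, Fintype.card_fin, smul_eq_mul, ← pow_mul, mul_comm m 2]
  have ht : t.Nonempty := Fintype.piFinset_nonempty.2 fun _ => ⟨0, by simp⟩
  obtain ⟨y, -, hy⟩ := Finset.exists_max_image t (fun y => (P.filter fun a => f a = y).card) ht
  refine ⟨(P.filter fun a => f a = y).card,
    nonempty_diCode_of_digits hq hη hcond hC _ (fun a ha l => ?_) fun a ha b hb l => ?_, ?_⟩
  · exact Fintype.mem_piFinset.1 (Finset.mem_filter.1 ha).1 l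
  · have h1 : f a l = f b l := by rw [(Finset.mem_filter.1 ha).2, (Finset.mem_filter.1 hb).2]
    have hpow : (0 : ℝ) < (((2 * q : ℕ) : ℝ) ^ m) ^ 2 := by positivity
    refine mul_right_cancel₀ hpow.ne' ?_
    simp only [Finset.sum_mul, ← mul_pow, digitTail_mul_pow hQ]
    exact_mod_cast h1
  · have h1 := Finset.card_eq_sum_card_fiberwise hf
    have h2 : P.card = C.card ^ m := by simp [P]
    have h3 : t.card = (n * (2 * q) ^ (2 * m) + 1) ^ m := by simp [t]
    rw [← h2, ← h3, h1, ← smul_eq_mul]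
    exact Finset.sum_le_card_nsmul _ _ _ hy

theorem exists_diCode_log_ge {m n q : ℕ} (hm : 1 ≤ m) (hn : 2 ≤ n) (hq : 1 ≤ q) {η : ℝ}
    (hη : 0 < η) (hQ : (2 * q) ^ (2 * m + 3) ≤ n) (hqη : 64 * (m : ℝ) ^ 3 ≤ η * (2 * q)) :
    ∃ N, Nonempty (DICode bernoulliChannel n N η η) ∧
      (m - 1) * n * Real.log q - m * n * Real.log 2 - 3 * m * Real.log n ≤ Real.log N := by
  have hm0 : (0 : ℝ) < m := by exact_mod_cast hm
  have hn0 : (0 : ℝ) < n := by exact_mod_cast (by omega : 0 < n)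
  have hq0 : (0 : ℝ) < q := by exact_mod_cast hq
  -- Distance `n / m` costs `(n / m) log q` per level, hence about one of the `m` levels in total:
  -- the source of `m - 1`.
  obtain ⟨C, hC, hCcard⟩ := exists_code_hammingDist_gt (n := n) hq (n / m)
  have hs : (n : ℝ) / m ≤ ((n / m : ℕ) : ℝ) + 1 := by
    rw [div_le_iff₀ hm0]
    exact_mod_cast (mul_comm m (n / m + 1) ▸ Nat.lt_mul_div_succ n hm).le
  have hQ' : ((2 * q : ℕ) : ℝ) ^ (2 * m + 3) ≤ n := by exact_mod_cast hQ
  have hcond : 64 * m * n * ((2 * q : ℕ) : ℝ) ^ (2 * m + 2) ≤ η * (((n / m : ℕ) : ℝ) + 1) ^ 2 := by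
    set Q : ℝ := ((2 * q : ℕ) : ℝ) with hQdef
    have hQ0 : 0 < Q := by rw [hQdef]; positivity
    have hqη' : 64 * (m : ℝ) ^ 3 ≤ η * Q := by rw [hQdef]; push_cast; exact hqη
    calc 64 * m * n * Q ^ (2 * m + 2)
        = (64 * (m : ℝ) ^ 3) * (n * Q ^ (2 * m + 2)) / (m : ℝ) ^ 2 := by field_simp
      _ ≤ (η * Q) * (n * Q ^ (2 * m + 2)) / (m : ℝ) ^ 2 := by gcongr
      _ = η * (n * Q ^ (2 * m + 3)) / (m : ℝ) ^ 2 := by ring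
      _ ≤ η * (n * n) / (m : ℝ) ^ 2 := by gcongr
      _ = η * ((n : ℝ) / m) ^ 2 := by field_simp
      _ ≤ _ := by gcongr
  obtain ⟨N, hN, hcard⟩ := exists_diCode_card_ge hq hη hcond hC
  refine ⟨N, hN, ?_⟩
  have hC0 : 0 < C.card := by
    by_contra h
    have : 0 < q ^ n := by positivity
    simp only [not_lt, nonpos_iff_eq_zero] at h
    rw [h, zero_mul] at hCcard
    omega
  have hN0 : 0 < N := by
    by_contra h
    have : 0 < C.card ^ m := by positivity
    simp only [not_lt, nonpos_iff_eq_zero] at h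
    rw [h, mul_zero] at hcard
    omega
  have hC0' : (0 : ℝ) < C.card := by exact_mod_cast hC0
  have hN0' : (0 : ℝ) < N := by exact_mod_cast hN0
  have h1 : n * Real.log q ≤
      Real.log C.card + (n * Real.log 2 + ((n / m : ℕ) : ℝ) * Real.log q) := by
    have h : (q : ℝ) ^ n ≤ C.card * (2 ^ n * q ^ (n / m)) := by exact_mod_cast hCcard
    have := Real.log_le_log (by positivity) h
    rwa [Real.log_mul (by positivity) (by positivity), Real.log_mul (by positivity) (by positivity),
      Real.log_pow, Real.log_pow, Real.log_pow] at this
  have h2 : m * Real.log C.card ≤ m * (3 * Real.log n) + Real.log N := by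
    have hle : n * (2 * q) ^ (2 * m) + 1 ≤ n ^ 3 := by
      have h := (Nat.pow_le_pow_right (by omega : 0 < 2 * q) (by omega : 2 * m ≤ 2 * m + 3)).trans hQ
      nlinarith [Nat.mul_le_mul_left n h, Nat.mul_le_mul hn hn, Nat.mul_le_mul_left (n * n) hn]
    have h : (C.card : ℝ) ^ m ≤ ((n : ℝ) ^ 3) ^ m * N := by
      exact_mod_cast hcard.trans (Nat.mul_le_mul_right _ (Nat.pow_le_pow_left hle m))
    have := Real.log_le_log (by positivity) h
    rw [Real.log_mul (by positivity) (by positivity), Real.log_pow, Real.log_pow,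
      Real.log_pow] at this
    exact_mod_cast this
  have h3 : (m : ℝ) * ((n / m : ℕ) : ℝ) ≤ n := by exact_mod_cast Nat.mul_div_le n m
  have h4 : 0 ≤ Real.log q := Real.log_nonneg (by exact_mod_cast hq)
  have h5 := mul_le_mul_of_nonneg_left h1 hm0.le
  have h6 := mul_le_mul_of_nonneg_right h3 h4
  linarith

/-! ### Asymptotics of the rate. -/

theorem eventually_exists_diCode {m : ℕ} (hm : 1 ≤ m) {η ε : ℝ} (hη : 0 < η) (hε : 0 < ε) :
    ∀ᶠ n : ℕ in atTop, ∃ N, Nonempty (DICode bernoulliChannel n N η η) ∧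
      (((m : ℝ) - 1) / (2 * m + 3) - ε) * (n * Real.log n) ≤ Real.log N := by
  have hm1 : (1 : ℝ) ≤ m := by exact_mod_cast hm
  have hp : (0 : ℝ) < 2 * m + 3 := by linarith
  have hx : Tendsto (fun n : ℕ => (n : ℝ) ^ ((1 : ℝ) / (2 * m + 3))) atTop atTop :=
    (tendsto_rpow_atTop (by positivity)).comp tendsto_natCast_atTop_atTop
  have hlog : Tendsto (fun n : ℕ => Real.log n) atTop atTop :=
    Real.tendsto_log_atTop.comp tendsto_natCast_atTop_atTop
  -- `x ≥ 4` makes `q = ⌊x / 2⌋₊` at least `x / 4 ≥ 1`. The next two thresholds each absorb half of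
  -- `ε`: the terms linear in `n`, and the pigeonhole loss `3 m log n`.
  filter_upwards [hx.eventually_ge_atTop (max 4 (128 * (m : ℝ) ^ 3 / η)),
    hlog.eventually_ge_atTop ((2 * (((m : ℝ) - 1) * Real.log 4 + m * Real.log 2)) / ε),
    tendsto_natCast_atTop_atTop.eventually_ge_atTop (6 * m / ε), eventually_ge_atTop 2]
    with n hxn hlogn hnε hn
  have hn0 : (0 : ℝ) < n := by exact_mod_cast (by omega : 0 < n)
  set x : ℝ := (n : ℝ) ^ ((1 : ℝ) / (2 * m + 3)) with hxdef
  have hx4 : 4 ≤ x := (le_max_left _ _).trans hxn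
  have hxη : 128 * (m : ℝ) ^ 3 ≤ x * η := (div_le_iff₀ hη).1 ((le_max_right _ _).trans hxn)
  have hxpow : x ^ (2 * m + 3) = n := by
    rw [hxdef, ← Real.rpow_natCast, ← Real.rpow_mul hn0.le]
    push_cast
    rw [one_div_mul_cancel hp.ne', Real.rpow_one]
  have hxlog : Real.log x = Real.log n / (2 * m + 3) := by
    rw [hxdef, Real.log_rpow hn0]; ring
  have hfl := Nat.floor_le (by linarith : 0 ≤ x / 2)
  have hfl' := Nat.lt_floor_add_one (x / 2)
  set q := ⌊x / 2⌋₊ with hq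
  have hqx : x / 4 ≤ q := by linarith
  obtain ⟨N, hN, hlogN⟩ := exists_diCode_log_ge (q := q) hm hn
    (by exact_mod_cast (by linarith : (1 : ℝ) ≤ q)) hη (by
      have : ((2 * q : ℕ) : ℝ) ^ (2 * m + 3) ≤ n := by
        rw [← hxpow]
        gcongr
        push_cast
        linarith
      exact_mod_cast this) (by nlinarith)
  refine ⟨N, hN, le_trans ?_ hlogN⟩
  have hlogq : Real.log n / (2 * m + 3) - Real.log 4 ≤ Real.log q := by
    rw [← hxlog, ← Real.log_div (by positivity) (by norm_num)]
    exact Real.log_le_log (by positivity) hqx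
  have h0 : 0 ≤ Real.log n := Real.log_natCast_nonneg n
  have h1 : ((m : ℝ) - 1) * n * (Real.log n / (2 * m + 3) - Real.log 4) ≤
      (m - 1) * n * Real.log q :=
    mul_le_mul_of_nonneg_left hlogq (mul_nonneg (by linarith) hn0.le)
  have h2 : 2 * (((m : ℝ) - 1) * Real.log 4 + m * Real.log 2) * n ≤ Real.log n * ε * n :=
    mul_le_mul_of_nonneg_right ((div_le_iff₀ hε).1 hlogn) hn0.le
  have h3 : 6 * m * Real.log n ≤ n * ε * Real.log n :=
    mul_le_mul_of_nonneg_right ((div_le_iff₀ hε).1 hnε) h0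
  have h4 : (((m : ℝ) - 1) / (2 * m + 3) - ε) * (n * Real.log n) =
      (m - 1) * n * (Real.log n / (2 * m + 3)) - ε * n * Real.log n := by
    field_simp
  rw [h4]
  linarith

/-- Rates arbitrarily close to `1 / 2` are reached with arbitrarily small errors. -/
theorem eventually_exists_diCode_half {η : ℝ} (hη : 0 < η) :
    ∀ᶠ n : ℕ in atTop, ∃ N, Nonempty (DICode bernoulliChannel n N η η) ∧
      (1 / 2 - η) * (n * Real.log n) ≤ Real.log N := by
  obtain ⟨m, hm⟩ := exists_nat_gt (3 / η)
  have hm0 : (0 : ℝ) < m := (by positivity : (0 : ℝ) < 3 / η).trans hm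
  have hm1 : 1 ≤ m := by exact_mod_cast hm0
  have hmη : 3 < m * η := (div_lt_iff₀ hη).1 hm
  filter_upwards [eventually_exists_diCode hm1 hη (half_pos hη)] with n hn
  obtain ⟨N, hN, hlog⟩ := hn
  refine ⟨N, hN, le_trans (mul_le_mul_of_nonneg_right ?_ ?_) hlog⟩
  · have : 1 / 2 - η / 2 ≤ ((m : ℝ) - 1) / (2 * m + 3) := by
      rw [le_div_iff₀ (by positivity)]
      nlinarith
    linarith
  · exact mul_nonneg n.cast_nonneg (Real.log_natCast_nonneg n)

theorem eventually_rate_le {N : ℕ → ℕ} {lam₁ lam₂ : ℕ → ℝ}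
    (hcode : ∀ n, 1 ≤ n → Nonempty (DICode bernoulliChannel n (N n) (lam₁ n) (lam₂ n)))
    (h₁ : Tendsto lam₁ atTop (𝓝 0)) (h₂ : Tendsto lam₂ atTop (𝓝 0)) :
    ∀ᶠ n : ℕ in atTop,
      Real.log (N n) / (n * Real.log n) ≤ 1 / 2 + Real.log 3 / Real.log n := by
  have hsum : Tendsto (fun n => √(lam₁ n) + √(lam₂ n)) atTop (𝓝 0) := by
    simpa using h₁.sqrt.add h₂.sqrt
  filter_upwards [hsum.eventually_lt_const (by norm_num : (0 : ℝ) < 1 / 2), eventually_ge_atTop 2]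
    with n hlam hn
  obtain ⟨c⟩ := hcode n (by omega)
  have hle := c.card_le (by omega) hlam
  have hn0 : (0 : ℝ) < n := by exact_mod_cast (by omega : 0 < n)
  have hlog : 0 < Real.log n := Real.log_pos (by exact_mod_cast hn)
  have hbase : (((⌊2 * √n⌋₊ + 1 : ℕ) : ℝ)) ≤ 3 * √n := by
    have h1 := Nat.floor_le (by positivity : 0 ≤ 2 * √(n : ℝ))
    have h2 : 1 ≤ √(n : ℝ) := Real.one_le_sqrt.2 (by exact_mod_cast (by omega : 1 ≤ n))
    push_cast
    linarith
  have hlogN : Real.log (N n) ≤ n * (Real.log 3 + Real.log n / 2) := by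
    rcases Nat.eq_zero_or_pos (N n) with h | h
    · rw [h, Nat.cast_zero, Real.log_zero]
      have : 0 < Real.log 3 := Real.log_pos (by norm_num)
      positivity
    · have h1 : (N n : ℝ) ≤ (3 * √n) ^ n :=
        le_trans (by exact_mod_cast hle) (pow_le_pow_left₀ (Nat.cast_nonneg _) hbase n)
      have h2 := Real.log_le_log (by exact_mod_cast h) h1
      rwa [Real.log_pow, Real.log_mul (by norm_num) (by positivity), Real.log_sqrt hn0.le] at h2
  rw [div_le_iff₀ (by positivity)]
  refine hlogN.trans_eq ?_
  field_simp
  ring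

theorem tendsto_half_add_log_three_div_log :
    Tendsto (fun n : ℕ => 1 / 2 + Real.log 3 / Real.log n) atTop (𝓝 (1 / 2)) := by
  simpa using ((Real.tendsto_log_atTop.comp tendsto_natCast_atTop_atTop).const_div_atTop
    (Real.log 3)).const_add (1 / 2 : ℝ)

/-- Diagonal choice: at length `n` use the largest `j ≤ n` for which a code with error and rate
deficit `1 / (j + 1)` exists. This `j` tends to infinity, and the converse supplies the upper half
of the squeeze. -/
theorem isAchievableLinearithmicRate_half :
    IsAchievableLinearithmicRate bernoulliChannel (1 / 2) := by
  classical
  let p : ℕ → ℕ → Prop := fun n j => ∃ N,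
    Nonempty (DICode bernoulliChannel n N (1 / ((j : ℝ) + 1)) (1 / ((j : ℝ) + 1))) ∧
      (1 / 2 - 1 / ((j : ℝ) + 1)) * (n * Real.log n) ≤ Real.log N
  -- For `j = 0` the empty code suffices: `Real.log 0 = 0` and the required rate is `-1 / 2`.
  have hp0 : ∀ n, p n 0 := fun n => by
    refine ⟨0, ⟨⟨Fin.elim0, Fin.elim0, fun i => i.elim0, by norm_num, by norm_num,
      fun i => i.elim0, fun i => i.elim0⟩⟩, ?_⟩
    have := mul_nonneg (Nat.cast_nonneg (α := ℝ) n) (Real.log_natCast_nonneg n)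
    norm_num
    linarith
  let J : ℕ → ℕ := fun n => Nat.findGreatest (p n) n
  have hJ : ∀ n, p n (J n) := fun n => Nat.findGreatest_spec (P := p n) (Nat.zero_le n) (hp0 n)
  have hJtop : Tendsto J atTop atTop := by
    refine tendsto_atTop.2 fun j => ?_
    filter_upwards [eventually_exists_diCode_half (η := 1 / ((j : ℝ) + 1)) (by positivity),
      eventually_ge_atTop j] with n hn hj
    exact Nat.le_findGreatest hj hn
  have hlim : Tendsto (fun n => 1 / ((J n : ℝ) + 1)) atTop (𝓝 0) :=
    tendsto_one_div_add_atTop_nhds_zero_nat.comp hJtop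
  choose N hN hlog using hJ
  refine ⟨by norm_num, N, _, _, fun n _ => hN n, hlim, hlim, ?_⟩
  refine tendsto_of_tendsto_of_tendsto_of_le_of_le' (g := fun n => 1 / 2 - 1 / ((J n : ℝ) + 1))
    (by simpa using hlim.const_sub (1 / 2 : ℝ)) tendsto_half_add_log_three_div_log ?_
    (eventually_rate_le (fun n _ => hN n) hlim hlim)
  filter_upwards [eventually_ge_atTop 2] with n hn
  have hn0 : (0 : ℝ) < n := by exact_mod_cast (by omega : 0 < n)
  have hlogn : 0 < Real.log n := Real.log_pos (by exact_mod_cast hn)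
  rw [le_div_iff₀ (by positivity)]
  exact hlog n

theorem mainTheorem2 : IsLinearithmicDICapacity bernoulliChannel (1 / 2) := by
  refine ⟨isAchievableLinearithmicRate_half, ?_⟩
  rintro R ⟨-, N, lam₁, lam₂, hcode, h₁, h₂, hR⟩
  exact le_of_tendsto_of_tendsto hR tendsto_half_add_log_three_div_log
    (eventually_rate_le hcode h₁ h₂)
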